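/- Let $n\ge 3$ and $q\ge 0$ be integers, let $-1<\xi<1$ be real, and let $\rho\in\mathbb C$ satisfy $q<\operatorname{Re}\rho<q+1$. Put $\lambda=\frac{n-2}{2}$ and $$h(u)=-\left(1+2u\xi+u^2\right)^{-\lambda}+\sum_{j=0}^{q}(-u)^jG_j^{\lambda}(\xi),\qquad u>0,$$ where the Gegenbauer polynomials $G_j^\lambda$ are given by the generating function $(1-2t\xi+t^2)^{-\lambda}=\sum_{j\ge0}t^jG_j^\lambda(\xi)$ (for small $|t|$). Let $$P^{\mu}_{\nu}(\xi)=\frac{1}{\Gamma(1-\mu)}\left(\frac{1+\xi}{1-\xi}\right)^{\mu/2}{}_2F_1\left(-\nu,\nu+1;1-\mu;\tfrac{1-\xi}{2}\right)$$ denote the associated Legendre function of the first kind on the cut $-1<\xi<1$. Then the Mellin transform of $h$ at $s=-\rho$, $$M(h,\rho)=\int_0^\infty h(u)\,u^{-\rho-1}\,du,$$ converges absolutely, and $$M(h,\rho)=\frac{\pi\sqrt{\pi}\;2^{(3-n)/2}\prod_{k=1}^{n-3}(\rho+k)\,(1-\xi^2)^{(3-n)/4}}{\sin(\pi\rho)\;\Gamma\left(\frac{n-2}{2}\right)}\,P^{(3-n)/2}_{-\rho-(n-1)/2}(\xi).$$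 Moreover $\sqrt{\pi}\,(n-3)!=2^{n-3}\,\Gamma\left(\frac{n-1}{2}\right)\Gamma\left(\frac{n-2}{2}\right)$, and equivalently $$M(h,\rho)=\frac{\pi\,2^{(n-3)/2}\prod_{k=1}^{n-3}(\rho+k)\,\Gamma\left(\frac{n-1}{2}\right)(1-\xi^2)^{(3-n)/4}}{(n-3)!\,\sin(\pi\rho)}\,P^{(3-n)/2}_{-\rho-(n-1)/2}(\xi).$$ -/

import Mathlib

noncomputable section

/-- The Riesz kernel `k_λ(t, ξ) = (1 + t² + 2tξ)^(-λ)`. For `-1 < ξ < 1` the base is a positive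
real number, so the complex power is the usual (principal) one. -/
def rieszKernel (lam : ℂ) (t ξ : ℝ) : ℂ :=
  ((1 + t ^ 2 + 2 * t * ξ : ℝ) : ℂ) ^ (-lam)

/-- The Gegenbauer (ultraspherical) polynomial `G_j^λ` at the real point `ξ`, defined as usual by
its generating function: it is the coefficient of `t^j` in the Taylor expansion at `t = 0` of
`(1 - 2tξ + t²)^(-λ)`. -/
def gegenbauer (lam : ℂ) (j : ℕ) (ξ : ℝ) : ℂ :=
  iteratedDeriv j (fun t : ℝ => ((1 - 2 * t * ξ + t ^ 2 : ℝ) : ℂ) ^ (-lam)) 0 / (j.factorial : ℂ)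

/-- The Weierstrass-type kernel of genus `q`,
`h(λ, q, u, ξ) = -(1 + 2uξ + u²)^(-λ) + ∑_{j=0}^q (-u)^j G_j^λ(ξ)`. -/
def weierstrassKernel (lam : ℂ) (q : ℕ) (u ξ : ℝ) : ℂ :=
  -rieszKernel lam u ξ + ∑ j ∈ Finset.range (q + 1), (-(u : ℂ)) ^ j * gegenbauer lam j ξ

/-- The associated Legendre function of the first kind on the cut `-1 < ξ < 1` (Ferrers function),
of degree `ν` and order `μ` with `μ ≠ 1, 2, 3, …`:
`P_ν^μ(ξ) = Γ(1-μ)⁻¹ ((1+ξ)/(1-ξ))^(μ/2) ₂F₁(-ν, ν+1; 1-μ; (1-ξ)/2)`. -/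
def legendreP (μ ν : ℂ) (ξ : ℝ) : ℂ :=
  (Complex.Gamma (1 - μ))⁻¹ * (((1 + ξ) / (1 - ξ) : ℝ) : ℂ) ^ (μ / 2) *
    ordinaryHypergeometric (-ν) (ν + 1) (1 - μ) (((1 - ξ) / 2 : ℝ) : ℂ)

end

/-!
Put `z = (1 - ξ) / 2`. Then `1 + 2uξ + u² = (1 + u)² - 4uz`, and since `4u / (1 + u)² ≤ 1` and
`0 < z < 1`, the binomial series gives for every `u ≥ 0`
`(1 + 2uξ + u²) ^ (-λ) = ∑ₖ (λ)ₖ / k! · (4z)ᵏ · uᵏ (1 + u) ^ (-2λ - 2k)` (`hasSum_rieszKernel`).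
Subtracting from the kernel its Taylor polynomial of order `q` amounts to replacing each factor
`(1 + u) ^ (-2λ - 2k)` by its own Taylor remainder of order `q - k`. The two ways of writing the
subtracted polynomial agree because both approximate the kernel to `o(u ^ q)` (`rieszPoly_eval`).

The Mellin transform of `(1 + u) ^ (-a)` at `s` is the beta integral `Γ(s) Γ(a - s) / Γ(a)`, and the
same value, with `s` moved to the left, is the transform of the Taylor remainders, by integration by
parts (`mellin_negBinomRem_succ`). Integrating term by term, with the tail `k > q` dominated by its
first term, gives
`M(h, ρ) = -Γ(-ρ) Γ(2λ + ρ) / Γ(2λ) · ₂F₁(-ρ, 2λ + ρ; λ + 1/2; z)` (`hasMellin_weierstrassKernel`).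

Euler's transformation `₂F₁(a, b; c; z) = (1 - z) ^ (c - a - b) ₂F₁(c - a, c - b; c; z)`
(`ordinaryHypergeometric_euler`) identifies this hypergeometric function with the Legendre function.
It holds because `(1 - X) ^ (c - a - b) · ₂F₁(c - a, c - b; c; X)` satisfies, as a formal power
series, the hypergeometric equation of `₂F₁(a, b; c; X)`, whose power series solution is determined
by its constant term. The reflection and duplication formulas for `Γ` give the constants.
-/

open Filter Topology Set MeasureTheory
open scoped Nat PowerSeries

/-! ### Euler's transformation of the hypergeometric function -/

/-- The Euler operator `θ = X · d/dX` on formal power series. -/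
noncomputable def eulerOp : Derivation ℂ ℂ⟦X⟧ ℂ⟦X⟧ :=
  (PowerSeries.X : ℂ⟦X⟧) • PowerSeries.derivative ℂ

lemma coeff_eulerOp (f : ℂ⟦X⟧) (n : ℕ) :
    PowerSeries.coeff n (eulerOp f) = n * PowerSeries.coeff n f := by
  cases n with
  | zero => simp [eulerOp]
  | succ n => simp [eulerOp, PowerSeries.coeff_succ_X_mul, PowerSeries.coeff_derivative, mul_comm]

lemma constantCoeff_eulerOp (f : ℂ⟦X⟧) : PowerSeries.constantCoeff (eulerOp f) = 0 := by
  simp [eulerOp]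

lemma eulerOp_X : eulerOp (PowerSeries.X : ℂ⟦X⟧) = PowerSeries.X := by
  simp [eulerOp]

lemma eulerOp_C (r : ℂ) : eulerOp (PowerSeries.C r) = 0 := by
  simp [eulerOp, PowerSeries.derivative_C]

lemma ordinaryHypergeometricCoefficient_succ (a b c : ℂ) (hc : ∀ k : ℕ, c ≠ -k) (n : ℕ) :
    ((n : ℂ) + 1) * (c + n) * ordinaryHypergeometricCoefficient a b c (n + 1) =
      (a + n) * (b + n) * ordinaryHypergeometricCoefficient a b c n := by
  have h1 : c + n ≠ 0 := fun h => hc n (by linear_combination h)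
  have h2 : ((n : ℂ) + 1) ≠ 0 := by exact_mod_cast n.succ_ne_zero
  have h3 : (n ! : ℂ) ≠ 0 := by exact_mod_cast n.factorial_ne_zero
  simp only [ordinaryHypergeometricCoefficient, ascPochhammer_succ_eval, Nat.factorial_succ,
    Nat.cast_mul, Nat.cast_succ, mul_inv]
  field_simp

/-- The hypergeometric differential equation, written as `θ(θ + c - 1) F = X (θ + a)(θ + b) F` and
expanded. -/
lemma eulerOp_hypergeometric_ode (a b c : ℂ) (hc : ∀ k : ℕ, c ≠ -k) (F : ℂ⟦X⟧)
    (hF : F = PowerSeries.mk (ordinaryHypergeometricCoefficient a b c)) :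
    (1 - PowerSeries.X) * eulerOp (eulerOp F)
      + (PowerSeries.C (c - 1) - PowerSeries.C (a + b) * PowerSeries.X) * eulerOp F
      - PowerSeries.C (a * b) * PowerSeries.X * F = 0 := by
  ext n
  cases n with
  | zero => simp [sub_mul, mul_assoc, constantCoeff_eulerOp]
  | succ n =>
    have := ordinaryHypergeometricCoefficient_succ a b c hc n
    simp only [sub_mul, add_mul, mul_assoc, map_add, map_sub, coeff_eulerOp,
      PowerSeries.coeff_succ_X_mul, PowerSeries.coeff_C_mul, one_mul, hF, PowerSeries.coeff_mk,
      map_zero]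
    push_cast
    linear_combination this

/-- The hypergeometric equation is a two-term recurrence for the coefficients, so it determines a
power series from its constant term. -/
lemma coeff_eq_of_hypergeometric_ode (a b c : ℂ) (hc : ∀ k : ℕ, c ≠ -k) (G : ℂ⟦X⟧)
    (h0 : PowerSeries.coeff 0 G = 1)
    (hG : (1 - PowerSeries.X) * eulerOp (eulerOp G)
      + (PowerSeries.C (c - 1) - PowerSeries.C (a + b) * PowerSeries.X) * eulerOp G
      - PowerSeries.C (a * b) * PowerSeries.X * G = 0) (n : ℕ) :
    PowerSeries.coeff n G = ordinaryHypergeometricCoefficient a b c n := by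
  induction n with
  | zero => simpa [ordinaryHypergeometricCoefficient] using h0
  | succ n ih =>
    have h := congrArg (PowerSeries.coeff (n + 1)) hG
    simp only [sub_mul, add_mul, mul_assoc, map_add, map_sub, coeff_eulerOp,
      PowerSeries.coeff_succ_X_mul, PowerSeries.coeff_C_mul, one_mul, map_zero] at h
    push_cast at h
    have h1 : c + n ≠ 0 := fun h => hc n (by linear_combination h)
    have h2 : ((n : ℂ) + 1) ≠ 0 := by exact_mod_cast n.succ_ne_zero
    refine mul_left_cancel₀ (mul_ne_zero h2 h1) ?_
    rw [ordinaryHypergeometricCoefficient_succ a b c hc n, ← ih]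
    linear_combination h

/-- Multiplication by `B = (1 - X) ^ (c - a - b)`, which enters only through its first-order
equation `hB`, turns the equation with parameters `c - a, c - b; c` into the one with parameters
`a, b; c`. -/
lemma binomial_mul_hypergeometric_ode (a b c : ℂ) (B H : ℂ⟦X⟧)
    (hB : (1 - PowerSeries.X) * eulerOp B = - (PowerSeries.C (c - a - b) * PowerSeries.X * B))
    (hH : (1 - PowerSeries.X) * eulerOp (eulerOp H)
      + (PowerSeries.C (c - 1) - PowerSeries.C (c - a + (c - b)) * PowerSeries.X) * eulerOp H
      - PowerSeries.C ((c - a) * (c - b)) * PowerSeries.X * H = 0) :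
    (1 - PowerSeries.X) * eulerOp (eulerOp (B * H))
      + (PowerSeries.C (c - 1) - PowerSeries.C (a + b) * PowerSeries.X) * eulerOp (B * H)
      - PowerSeries.C (a * b) * PowerSeries.X * (B * H) = 0 := by
  have hB2 := congrArg eulerOp hB
  simp only [Derivation.leibniz, map_sub, map_add, map_neg, Derivation.map_one_eq_zero, smul_eq_mul,
    eulerOp_X, eulerOp_C] at hB2 hB hH ⊢
  simp only [map_mul, map_sub, map_one] at hB2 hB hH ⊢
  linear_combination (H) * hB2 + (2 * eulerOp H + (PowerSeries.C c - 1) * H) * hB + B * hH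

/-- The Cauchy product identity behind Euler's transformation. -/
lemma sum_antidiagonal_binomial_hypergeometric (a b c : ℂ) (hc : ∀ k : ℕ, c ≠ -k) (n : ℕ) :
    ∑ kl ∈ Finset.HasAntidiagonal.antidiagonal n,
      ordinaryHypergeometricCoefficient (-(c - a - b)) 1 1 kl.1 *
        ordinaryHypergeometricCoefficient (c - a) (c - b) c kl.2 =
    ordinaryHypergeometricCoefficient a b c n := by
  rw [← coeff_eq_of_hypergeometric_ode a b c hc
    (PowerSeries.mk (ordinaryHypergeometricCoefficient (-(c - a - b)) 1 1) *
      PowerSeries.mk (ordinaryHypergeometricCoefficient (c - a) (c - b) c))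
    (by simp [ordinaryHypergeometricCoefficient])
    (binomial_mul_hypergeometric_ode a b c _ _ ?_
      (eulerOp_hypergeometric_ode (c - a) (c - b) c hc _ rfl)) n]
  · simp [PowerSeries.coeff_mul]
  · ext n
    cases n with
    | zero => simp [sub_mul, mul_assoc, constantCoeff_eulerOp]
    | succ n =>
      have h1 : ∀ k : ℕ, (1 : ℂ) ≠ -k := fun k h => by
        have : ((1 + k : ℕ) : ℂ) = 0 := by push_cast; linear_combination h
        norm_cast at this; omega
      have := ordinaryHypergeometricCoefficient_succ (-(c - a - b)) 1 1 h1 n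
      have h2 : (1 + (n : ℂ)) ≠ 0 := fun h => h1 n (by linear_combination h)
      simp only [sub_mul, mul_assoc, map_neg, map_sub, coeff_eulerOp, PowerSeries.coeff_succ_X_mul,
        PowerSeries.coeff_C_mul, one_mul, PowerSeries.coeff_mk]
      push_cast
      refine mul_left_cancel₀ h2 ?_
      linear_combination this

/-- The binomial series of `(1 - z) ^ m`, with coefficients written as Pochhammer quotients. -/
lemma hasSum_one_sub_cpow (m z : ℂ) (hz : ‖z‖ < 1) :
    HasSum (fun n => ordinaryHypergeometricCoefficient (-m) 1 1 n * z ^ n) ((1 - z) ^ m) ∧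
    Summable (fun n => ‖ordinaryHypergeometricCoefficient (-m) 1 1 n * z ^ n‖) := by
  have hz' : -z ∈ Metric.eball (0 : ℂ) 1 := by
    rw [Metric.mem_eball, edist_zero_right, enorm_neg]
    exact ENNReal.coe_lt_one_iff.2 hz
  have hterm : ∀ n, (binomialSeries ℂ m n fun _ => -z) =
      ordinaryHypergeometricCoefficient (-m) 1 1 n * z ^ n := by
    intro n
    rw [binomialSeries_eq_ordinaryHypergeometricSeries (b := (1 : ℂ)) (by norm_cast; simp)]
    change ordinaryHypergeometricSeries ℂ (-m) 1 1 n (fun _ => -(-z)) = _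
    rw [neg_neg, ordinaryHypergeometricSeries_apply_eq, smul_eq_mul]
  constructor
  · have := Complex.one_add_cpow_hasFPowerSeriesOnBall_zero (a := m) |>.hasSum hz'
    simpa [hterm, ← sub_eq_add_neg] using this
  · have := (binomialSeries ℂ m).summable_norm_apply
      (Metric.eball_subset_eball binomialSeries_radius_ge_one hz')
    simpa only [hterm] using this

/-- **Euler's transformation** `₂F₁(a, b; c; z) = (1 - z)^(c-a-b) ₂F₁(c-a, c-b; c; z)` on the unit
disc. -/
theorem ordinaryHypergeometric_euler (a b c z : ℂ) (hz : ‖z‖ < 1)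
    (hca : ∀ k : ℕ, c - a ≠ -k) (hcb : ∀ k : ℕ, c - b ≠ -k) (hc : ∀ k : ℕ, c ≠ -k) :
    ordinaryHypergeometric a b c z =
      (1 - z) ^ (c - a - b) * ordinaryHypergeometric (c - a) (c - b) c z := by
  obtain ⟨hB, hBn⟩ := hasSum_one_sub_cpow (c - a - b) z hz
  have hHn : Summable (fun n =>
      ‖ordinaryHypergeometricCoefficient (c - a) (c - b) c n * z ^ n‖) := by
    have hr := ordinaryHypergeometricSeries_radius_eq_one ℂ (c - a) (c - b) c
      (fun k => ⟨fun h => hca k (by rw [h]; ring), fun h => hcb k (by rw [h]; ring),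
        fun h => hc k (by rw [h]; ring)⟩)
    have hz' : z ∈ Metric.eball (0 : ℂ)
        (ordinaryHypergeometricSeries ℂ (c - a) (c - b) c).radius := by
      rw [hr, Metric.mem_eball, edist_zero_right]
      exact ENNReal.coe_lt_one_iff.2 hz
    simpa only [ordinaryHypergeometricSeries_apply_eq, smul_eq_mul] using
      FormalMultilinearSeries.summable_norm_apply _ hz'
  rw [ordinaryHypergeometric_eq_tsum, ordinaryHypergeometric_eq_tsum]
  simp only [smul_eq_mul]
  rw [← hB.tsum_eq, tsum_mul_tsum_eq_tsum_sum_antidiagonal_of_summable_norm hBn hHn]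
  refine tsum_congr fun n => ?_
  have := sum_antidiagonal_binomial_hypergeometric a b c hc n
  change ordinaryHypergeometricCoefficient a b c n * z ^ n = _
  rw [← this, Finset.sum_mul]
  refine Finset.sum_congr rfl fun kl hkl => ?_
  rw [← Finset.HasAntidiagonal.mem_antidiagonal.1 hkl, pow_add]
  ring

/-! ### Taylor remainders of the binomial `(1 + u) ^ (-a)` -/

/-- The coefficient of `u ^ j` in the binomial series of `(1 + u) ^ (-a)`. -/
noncomputable def negBinomCoeff (a : ℂ) (j : ℕ) : ℂ :=
  (-1) ^ j * ordinaryHypergeometricCoefficient a 1 1 j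

lemma negBinomCoeff_zero (a : ℂ) : negBinomCoeff a 0 = 1 := by
  simp [negBinomCoeff, ordinaryHypergeometricCoefficient]

lemma ordinaryHypergeometricCoefficient_one_one (a : ℂ) (j : ℕ) :
    ordinaryHypergeometricCoefficient a 1 1 j = (ascPochhammer ℂ j).eval a / j ! := by
  have h3 : (j ! : ℂ) ≠ 0 := by exact_mod_cast j.factorial_ne_zero
  simp only [ordinaryHypergeometricCoefficient, ascPochhammer_eval_one]
  field_simp

lemma negBinomCoeff_succ (a : ℂ) (j : ℕ) :
    ((j : ℂ) + 1) * negBinomCoeff a (j + 1) = -a * negBinomCoeff (a + 1) j := by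
  have h2 : ((j : ℂ) + 1) ≠ 0 := by exact_mod_cast j.succ_ne_zero
  have h3 : (j ! : ℂ) ≠ 0 := by exact_mod_cast j.factorial_ne_zero
  simp only [negBinomCoeff, ordinaryHypergeometricCoefficient_one_one, ascPochhammer_succ_left,
    Nat.factorial_succ, Nat.cast_mul, Nat.cast_succ, Polynomial.eval_mul, Polynomial.eval_X,
    Polynomial.eval_comp, Polynomial.eval_add, Polynomial.eval_one]
  field_simp
  ring

/-- `(1 + u) ^ (-a)` minus the first `N` terms of its binomial series. -/
noncomputable def negBinomRem (a : ℂ) (N : ℕ) (u : ℝ) : ℂ :=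
  ((1 + u : ℝ) : ℂ) ^ (-a) - ∑ j ∈ Finset.range N, negBinomCoeff a j * (u : ℂ) ^ j

lemma negBinomRem_succ_zero (a : ℂ) (N : ℕ) : negBinomRem a (N + 1) 0 = 0 := by
  simp [negBinomRem, Finset.sum_range_succ', negBinomCoeff_zero]

lemma hasDerivAt_negBinomRem (a : ℂ) (N : ℕ) {u : ℝ} (hu : -1 < u) :
    HasDerivAt (negBinomRem a (N + 1)) (-a * negBinomRem (a + 1) N u) u := by
  have hpos : (0 : ℝ) < 1 + u := by linarith
  have h2 : HasDerivAt (fun x : ℝ => ((1 + x : ℝ) : ℂ) ^ (-a))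
      (-a * ((1 + u : ℝ) : ℂ) ^ (-a - 1)) u := by
    have := (((hasDerivAt_id (u : ℂ)).const_add 1).cpow_const (c := -a)
      (Or.inl (by simpa using hpos))).comp_ofReal
    simpa using this
  have h3 : HasDerivAt
      (fun x : ℝ => ∑ j ∈ Finset.range (N + 1), negBinomCoeff a j * (x : ℂ) ^ j)
      (∑ j ∈ Finset.range (N + 1), negBinomCoeff a j * (j * (u : ℂ) ^ (j - 1))) u := by
    refine HasDerivAt.fun_sum fun j _ => ?_
    exact ((hasDerivAt_pow j (u : ℂ)).comp_ofReal).const_mul _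
  refine (h2.sub h3).congr_deriv ?_
  rw [Finset.sum_range_succ', negBinomRem, mul_sub, Finset.mul_sum]
  have h5 : ∀ j : ℕ, negBinomCoeff a (j + 1) * (((j + 1 : ℕ) : ℂ) * (u : ℂ) ^ (j + 1 - 1)) =
      -a * (negBinomCoeff (a + 1) j * (u : ℂ) ^ j) := fun j => by
    have := negBinomCoeff_succ a j
    push_cast
    linear_combination (u : ℂ) ^ j * this
  simp only [h5]
  rw [show -(a + 1) = -a - 1 by ring]
  simp

lemma continuousOn_negBinomRem (a : ℂ) (N : ℕ) : ContinuousOn (negBinomRem a N) (Ioi (-1)) := by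
  unfold negBinomRem
  refine ContinuousOn.sub ?_ (by fun_prop)
  refine ContinuousOn.cpow_const (by fun_prop) fun x hx => Or.inl ?_
  simp only [Complex.ofReal_re]
  have : -1 < x := hx
  linarith

lemma norm_negBinomRem_zero (a : ℂ) {u : ℝ} (hu : 0 ≤ u) :
    ‖negBinomRem a 0 u‖ = (1 + u) ^ (-a.re) := by
  simp only [negBinomRem, Finset.range_zero, Finset.sum_empty, sub_zero]
  rw [Complex.norm_cpow_eq_rpow_re_of_pos (by linarith)]
  simp

lemma norm_negBinomRem_le (a : ℂ) (ha : 0 ≤ a.re) (N : ℕ) :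
    ∃ C, 0 ≤ C ∧ ∀ u : ℝ, 0 ≤ u → ‖negBinomRem a N u‖ ≤ C * u ^ N := by
  induction N generalizing a with
  | zero =>
    refine ⟨1, zero_le_one, fun u hu => ?_⟩
    rw [norm_negBinomRem_zero a hu, pow_zero, mul_one]
    exact Real.rpow_le_one_of_one_le_of_nonpos (by linarith) (by linarith)
  | succ N ih =>
    obtain ⟨C, hC, h⟩ := ih (a + 1) (by simp; linarith)
    refine ⟨‖a‖ * C, by positivity, fun u hu => ?_⟩
    have hb : ∀ x ∈ Icc (0 : ℝ) u, ‖-a * negBinomRem (a + 1) N x‖ ≤ ‖a‖ * C * u ^ N := by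
      intro x hx
      rw [norm_mul, norm_neg, mul_assoc]
      gcongr
      refine (h x hx.1).trans ?_
      have := hx.1
      have := hx.2
      gcongr
    have := (convex_Icc (0 : ℝ) u).norm_image_sub_le_of_norm_hasDerivWithin_le
      (fun x hx => (hasDerivAt_negBinomRem a N
        (show (-1 : ℝ) < x by have := hx.1; linarith)).hasDerivWithinAt) hb
      (left_mem_Icc.2 hu) (right_mem_Icc.2 hu)
    rw [negBinomRem_succ_zero, sub_zero, sub_zero, Real.norm_of_nonneg hu] at this
    rw [pow_succ, ← mul_assoc]
    exact this

/-- The bound that matters at infinity: the last subtracted term dominates. -/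
lemma norm_negBinomRem_succ_le (a : ℂ) (ha : 0 ≤ a.re) (N : ℕ) :
    ∃ C, 0 ≤ C ∧ ∀ u : ℝ, 0 ≤ u → ‖negBinomRem a (N + 1) u‖ ≤ C * u ^ N := by
  obtain ⟨C, hC, h⟩ := norm_negBinomRem_le a ha N
  refine ⟨C + ‖negBinomCoeff a N‖, by positivity, fun u hu => ?_⟩
  have : negBinomRem a (N + 1) u = negBinomRem a N u - negBinomCoeff a N * (u : ℂ) ^ N := by
    simp only [negBinomRem, Finset.sum_range_succ]; ring
  rw [this, add_mul]
  refine (norm_sub_le _ _).trans (add_le_add (h u hu) ?_)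
  rw [norm_mul, norm_pow, Complex.norm_real, Real.norm_of_nonneg hu]

lemma mellinConvergent_of_norm_le {f : ℝ → ℂ} (hf : ContinuousOn f (Ioi 0)) {A B : ℝ} {C D : ℝ}
    (hA : ∀ᶠ u in atTop, ‖f u‖ ≤ C * u ^ (-A)) (hB : ∀ᶠ u in 𝓝[>] (0 : ℝ), ‖f u‖ ≤ D * u ^ (-B))
    {s : ℂ} (hsA : s.re < A) (hsB : B < s.re) : MellinConvergent f s := by
  refine mellinConvergent_of_isBigO_rpow (hf.locallyIntegrableOn measurableSet_Ioi)
    (Asymptotics.IsBigO.of_bound C ?_) hsA (Asymptotics.IsBigO.of_bound D ?_) hsB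
  · filter_upwards [hA, eventually_gt_atTop 0] with u hu h0
    rwa [Real.norm_of_nonneg (by positivity)]
  · filter_upwards [hB, self_mem_nhdsWithin] with u hu h0
    have h0 : 0 < u := h0
    rwa [Real.norm_of_nonneg (by positivity)]

lemma mellinConvergent_negBinomRem_zero (a s : ℂ) (hs : 0 < s.re) (hsa : s.re < a.re) :
    MellinConvergent (negBinomRem a 0) s := by
  refine mellinConvergent_of_norm_le (C := 1) (D := 1) (A := a.re) (B := 0)
    ((continuousOn_negBinomRem a 0).mono (Ioi_subset_Ioi (by norm_num))) ?_ ?_ hsa hs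
  · filter_upwards [eventually_gt_atTop 0] with u hu
    rw [norm_negBinomRem_zero a hu.le, one_mul]
    exact Real.rpow_le_rpow_of_nonpos hu (by linarith) (by linarith)
  · filter_upwards [self_mem_nhdsWithin] with u hu
    have hu : 0 < u := hu
    rw [norm_negBinomRem_zero a hu.le, neg_zero, Real.rpow_zero, mul_one]
    exact Real.rpow_le_one_of_one_le_of_nonpos (by linarith) (by linarith)

lemma mellinConvergent_negBinomRem_succ (a s : ℂ) (N : ℕ) (ha : 0 ≤ a.re)
    (hs : -(N + 1 : ℝ) < s.re) (hs' : s.re < -(N : ℝ)) :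
    MellinConvergent (negBinomRem a (N + 1)) s := by
  obtain ⟨C, -, hC⟩ := norm_negBinomRem_succ_le a ha N
  obtain ⟨D, -, hD⟩ := norm_negBinomRem_le a ha (N + 1)
  refine mellinConvergent_of_norm_le (C := C) (D := D) (A := -N) (B := -(N + 1 : ℝ))
    ((continuousOn_negBinomRem a _).mono (Ioi_subset_Ioi (by norm_num))) ?_ ?_ hs' hs
  · filter_upwards [eventually_gt_atTop 0] with u hu
    simpa using hC u hu.le
  · filter_upwards [self_mem_nhdsWithin] with u hu
    have := hD u (le_of_lt hu)
    rw [neg_neg]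
    exact_mod_cast this

/-- The beta integral on the half-line, obtained from the one on `(0, 1)` by `x = u / (1 + u)`. -/
lemma mellin_negBinomRem_zero (a s : ℂ) (hs : 0 < s.re) (hsa : s.re < a.re) :
    mellin (negBinomRem a 0) s = Complex.Gamma s * Complex.Gamma (a - s) / Complex.Gamma a := by
  have ha : Complex.Gamma a ≠ 0 := Complex.Gamma_ne_zero_of_re_pos (hs.trans hsa)
  rw [Complex.Gamma_mul_Gamma_eq_betaIntegral hs (by simpa using hsa), add_sub_cancel,
    mul_div_cancel_left₀ _ ha]
  have himg : (fun u : ℝ => u / (1 + u)) '' Ioi 0 = Ioo 0 1 := by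
    ext x
    constructor
    · rintro ⟨u, hu, rfl⟩
      have hu : 0 < u := hu
      exact ⟨by positivity, by simp only; rw [div_lt_one (by positivity)]; linarith⟩
    · rintro ⟨h0, h1⟩
      have h2 : 1 - x ≠ 0 := by linarith
      refine ⟨x / (1 - x), div_pos h0 (by linarith), ?_⟩
      simp only
      field_simp
      ring
  have hinj : InjOn (fun u : ℝ => u / (1 + u)) (Ioi 0) := by
    intro u hu v hv h
    have hu : 0 < u := hu
    have hv : 0 < v := hv
    simp only at h
    field_simp at h
    linarith
  have hder : ∀ u ∈ Ioi (0 : ℝ), HasDerivWithinAt (fun u : ℝ => u / (1 + u)) (1 / (1 + u) ^ 2)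
      (Ioi 0) u := by
    intro u hu
    have hu : 0 < u := hu
    have := (hasDerivAt_id u).div ((hasDerivAt_id u).const_add 1) (by simp; positivity)
    refine (this.congr_deriv ?_).hasDerivWithinAt
    simp
  rw [Complex.betaIntegral, intervalIntegral.integral_of_le zero_le_one,
    integral_Ioc_eq_integral_Ioo, ← himg,
    integral_image_eq_integral_abs_deriv_smul measurableSet_Ioi hder hinj, mellin]
  refine setIntegral_congr_fun measurableSet_Ioi fun u hu => ?_
  have hu : 0 < u := hu
  have h1 : (0 : ℝ) < 1 + u := by linarith
  have hne : ((1 + u : ℝ) : ℂ) ≠ 0 := by exact_mod_cast h1.ne'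
  simp only [negBinomRem, Finset.range_zero, Finset.sum_empty, sub_zero]
  have e1 : (1 : ℂ) - ((u / (1 + u) : ℝ) : ℂ) = (((1 + u)⁻¹ : ℝ) : ℂ) := by
    rw [← Complex.ofReal_one, ← Complex.ofReal_sub]
    congr 1
    field_simp
    ring
  have e2 : ∀ w : ℂ, (((1 + u)⁻¹ : ℝ) : ℂ) ^ w = ((1 + u : ℝ) : ℂ) ^ (-w) := by
    intro w
    rw [Complex.ofReal_inv, Complex.inv_cpow _ _ (by
      rw [Complex.arg_ofReal_of_nonneg h1.le]; exact Real.pi_pos.ne), Complex.cpow_neg]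
  rw [e1, abs_of_pos (by positivity), div_eq_mul_inv u, Complex.ofReal_mul,
    Complex.mul_cpow_ofReal_nonneg hu.le (by positivity), e2, e2]
  rw [Complex.real_smul, smul_eq_mul, mul_assoc, ← Complex.cpow_add _ _ hne]
  rw [show ((1 / (1 + u) ^ 2 : ℝ) : ℂ) = ((1 + u : ℝ) : ℂ) ^ (-2 : ℂ) by
    rw [Complex.cpow_neg]; push_cast; simp]
  rw [mul_left_comm, ← Complex.cpow_add _ _ hne]
  congr 2
  ring

/-- The regularised beta integral: subtracting Taylor terms continues
`∫ u^(s-1) (1+u)^(-a) du = Γ(s) Γ(a-s) / Γ(a)` to negative real parts of `s`. Each integration by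
parts lowers the order of the remainder by one. -/
lemma mellin_negBinomRem_succ (N : ℕ) (a s : ℂ) (ha : 0 < a.re)
    (hs : -(N + 1 : ℝ) < s.re) (hs' : s.re < -(N : ℝ)) :
    mellin (negBinomRem a (N + 1)) s =
      Complex.Gamma s * Complex.Gamma (a - s) / Complex.Gamma a := by
  have hs0 : s ≠ 0 := by
    rintro rfl
    have : (0 : ℝ) ≤ N := N.cast_nonneg
    simp at hs'
    linarith
  have ha0 : a ≠ 0 := by rintro rfl; simp at ha
  have hN : (0 : ℝ) ≤ N := N.cast_nonneg
  have key : mellin (negBinomRem (a + 1) N) (s + 1) =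
      Complex.Gamma (s + 1) * Complex.Gamma (a + 1 - (s + 1)) / Complex.Gamma (a + 1) ∧
      MellinConvergent (negBinomRem (a + 1) N) (s + 1) := by
    cases N with
    | zero =>
      have h1 : 0 < (s + 1).re := by simp at hs ⊢; linarith
      have h2 : (s + 1).re < (a + 1).re := by simp at hs' ⊢; linarith
      exact ⟨mellin_negBinomRem_zero _ _ h1 h2, mellinConvergent_negBinomRem_zero _ _ h1 h2⟩
    | succ N =>
      push_cast at hs hs'
      have h1 : -(N + 1 : ℝ) < (s + 1).re := by simp; linarith
      have h2 : (s + 1).re < -(N : ℝ) := by simp; linarith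
      exact ⟨mellin_negBinomRem_succ N (a + 1) (s + 1) (by simp; linarith) h1 h2,
        mellinConvergent_negBinomRem_succ _ _ _ (by simp; linarith) h1 h2⟩
  obtain ⟨hval, hconv⟩ := key
  have hconv' := mellinConvergent_negBinomRem_succ a s N ha.le hs hs'
  have hu : ∀ x ∈ Ioi (0 : ℝ), HasDerivAt (fun x : ℝ => (x : ℂ) ^ s / s) ((x : ℂ) ^ (s - 1)) x := by
    intro x hx
    have := (((hasDerivAt_id (x : ℂ)).cpow_const (c := s)
      (Or.inl (by simpa using hx))).div_const s).comp_ofReal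
    refine this.congr_deriv ?_
    simp only [id_eq, mul_one]
    field_simp
  have hv : ∀ x ∈ Ioi (0 : ℝ), HasDerivAt (negBinomRem a (N + 1))
      (-a * negBinomRem (a + 1) N x) x := fun x hx =>
    hasDerivAt_negBinomRem a N (by have : 0 < x := hx; linarith)
  have hnorm : ∀ x : ℝ, 0 < x → ∀ C M : ℝ, ‖negBinomRem a (N + 1) x‖ ≤ C * x ^ M →
      ‖(x : ℂ) ^ s / s * negBinomRem a (N + 1) x‖ ≤ C / ‖s‖ * x ^ (s.re + M) := by
    intro x hx C M h
    rw [norm_mul, norm_div, Complex.norm_cpow_eq_rpow_re_of_pos hx, Real.rpow_add hx]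
    calc _ ≤ x ^ s.re / ‖s‖ * (C * x ^ M) := by gcongr
      _ = _ := by ring
  -- The boundary terms vanish: the remainder is `O(u ^ (N + 1))` at `0` and `O(u ^ N)` at infinity.
  obtain ⟨C, -, hC⟩ := norm_negBinomRem_succ_le a ha.le N
  obtain ⟨D, -, hD⟩ := norm_negBinomRem_le a ha.le (N + 1)
  have hparts := integral_Ioi_mul_deriv_eq_deriv_mul (a := (0 : ℝ)) (a' := 0) (b' := 0) hu hv
    ?_ ?_ ?_ ?_
  · have e1 : ∫ x in Ioi (0 : ℝ), (x : ℂ) ^ s / s * (-a * negBinomRem (a + 1) N x) =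
        (-a / s) * mellin (negBinomRem (a + 1) N) (s + 1) := by
      rw [mellin, ← integral_const_mul]
      refine integral_congr_ae (Eventually.of_forall fun x => ?_)
      simp only [smul_eq_mul, add_sub_cancel_right]
      ring
    rw [e1, hval] at hparts
    have e2 : mellin (negBinomRem a (N + 1)) s =
        ∫ x in Ioi (0 : ℝ), (x : ℂ) ^ (s - 1) * negBinomRem a (N + 1) x := rfl
    rw [e2]
    have hG : Complex.Gamma a ≠ 0 := Complex.Gamma_ne_zero_of_re_pos ha
    rw [Complex.Gamma_add_one _ hs0, Complex.Gamma_add_one _ ha0,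
      show a + 1 - (s + 1) = a - s by ring] at hparts
    field_simp at hparts ⊢
    linear_combination hparts
  · have : IntegrableOn (fun x : ℝ => (-a / s) * ((x : ℂ) ^ (s + 1 - 1) • negBinomRem (a + 1) N x))
      (Ioi 0) := Integrable.const_mul hconv _
    refine this.congr (Eventually.of_forall fun x => ?_)
    simp only [smul_eq_mul, add_sub_cancel_right, Pi.mul_apply]
    ring
  · exact hconv'
  · refine squeeze_zero_norm' (a := fun x : ℝ => D / ‖s‖ * x ^ (s.re + (N + 1 : ℝ))) ?_ ?_
    · filter_upwards [self_mem_nhdsWithin] with x hx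
      exact hnorm x hx D _ (by exact_mod_cast hD x (le_of_lt hx))
    · have h0 : ContinuousAt (fun x : ℝ => D / ‖s‖ * x ^ (s.re + (N + 1 : ℝ))) 0 :=
        (Real.continuousAt_rpow_const _ _ (Or.inr (by linarith))).const_mul _
      have := h0.tendsto
      rw [Real.zero_rpow (by linarith), mul_zero] at this
      exact this.mono_left nhdsWithin_le_nhds
  · refine squeeze_zero_norm' (a := fun x : ℝ => C / ‖s‖ * x ^ (s.re + (N : ℝ))) ?_ ?_
    · filter_upwards [eventually_gt_atTop 0] with x hx
      exact hnorm x hx C _ (by simpa using hC x hx.le)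
    · have := (tendsto_rpow_neg_atTop (y := -(s.re + N)) (by linarith)).const_mul (C / ‖s‖)
      simpa using this

/-! ### Expansion of the Riesz kernel and its Taylor polynomial -/

lemma polynomial_eq_zero_of_isLittleO (N : ℕ) (P : Polynomial ℂ) (hP : P.natDegree ≤ N)
    (h : (fun u : ℝ => P.eval (u : ℂ)) =o[𝓝[>] 0] fun u : ℝ => u ^ N) : P = 0 := by
  induction N generalizing P with
  | zero =>
    obtain ⟨a, rfl⟩ := Polynomial.natDegree_eq_zero.1 (Nat.le_zero.1 hP)
    have h' : Tendsto (fun _ : ℝ => a) (𝓝[>] 0) (𝓝 0) := by simpa using h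
    rw [show a = 0 from tendsto_nhds_unique tendsto_const_nhds h', map_zero]
  | succ N ih =>
    have h0 : P.coeff 0 = 0 := by
      have h1 : Tendsto (fun u : ℝ => P.eval (u : ℂ)) (𝓝[>] 0) (𝓝 0) := by
        refine h.trans_tendsto ?_
        have : ContinuousAt (fun u : ℝ => u ^ (N + 1)) 0 := by fun_prop
        have := this.tendsto.mono_left (nhdsWithin_le_nhds (s := Ioi (0 : ℝ)))
        simpa using this
      have h2 : Tendsto (fun u : ℝ => P.eval (u : ℂ)) (𝓝[>] 0) (𝓝 (P.eval ((0 : ℝ) : ℂ))) := by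
        have : Continuous fun u : ℝ => P.eval (u : ℂ) := by fun_prop
        exact this.continuousAt.tendsto.mono_left nhdsWithin_le_nhds
      rw [Polynomial.coeff_zero_eq_eval_zero]
      simpa using (tendsto_nhds_unique h1 h2).symm
    have hdiv : P = P.divX * Polynomial.X := by
      conv_lhs => rw [← Polynomial.divX_mul_X_add P, h0, map_zero, add_zero]
    rw [hdiv, ih P.divX (by rw [Polynomial.natDegree_divX_eq_natDegree_tsub_one]; omega), zero_mul]
    have h3 := (Asymptotics.isBigO_refl (fun u : ℝ => u⁻¹) (𝓝[>] 0)).smul_isLittleO h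
    refine h3.congr' ?_ ?_
    · filter_upwards [self_mem_nhdsWithin] with u hu
      have hu : (u : ℂ) ≠ 0 := by exact_mod_cast (ne_of_gt hu)
      conv_lhs => rw [hdiv]
      rw [Polynomial.eval_mul, Polynomial.eval_X, Complex.real_smul]
      push_cast
      field_simp
    · filter_upwards [self_mem_nhdsWithin] with u hu
      have hu : u ≠ 0 := ne_of_gt hu
      rw [smul_eq_mul, pow_succ]
      field_simp

lemma quadratic_pos {ξ : ℝ} (hξ : -1 < ξ) (hξ' : ξ < 1) (t : ℝ) : 0 < 1 + t ^ 2 + 2 * t * ξ := by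
  nlinarith [sq_nonneg (t + ξ)]

lemma contDiff_gegenbauer_generating (lam : ℂ) {ξ : ℝ} (hξ : -1 < ξ) (hξ' : ξ < 1) {n : ℕ} :
    ContDiff ℝ n (fun t : ℝ => ((1 - 2 * t * ξ + t ^ 2 : ℝ) : ℂ) ^ (-lam)) := by
  have hpos : ∀ t : ℝ, 0 < 1 - 2 * t * ξ + t ^ 2 := fun t => by
    have := quadratic_pos hξ hξ' (-t)
    nlinarith
  have heq : (fun t : ℝ => ((1 - 2 * t * ξ + t ^ 2 : ℝ) : ℂ) ^ (-lam)) =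
      fun t : ℝ => Complex.exp ((Real.log (1 - 2 * t * ξ + t ^ 2) : ℝ) * (-lam)) := by
    ext t
    rw [Complex.cpow_def_of_ne_zero (by exact_mod_cast (hpos t).ne'),
      Complex.ofReal_log (hpos t).le]
  rw [heq]
  refine ContDiff.cexp (ContDiff.mul ?_ contDiff_const)
  refine Complex.ofRealCLM.contDiff.comp ?_
  exact ContDiff.log (by fun_prop) fun t => (hpos t).ne'

lemma rieszKernel_sub_taylor_isLittleO (lam : ℂ) (q : ℕ) {ξ : ℝ} (hξ : -1 < ξ) (hξ' : ξ < 1) :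
    (fun u : ℝ => rieszKernel lam u ξ -
      ∑ j ∈ Finset.range (q + 1), (-(u : ℂ)) ^ j * gegenbauer lam j ξ)
      =o[𝓝[>] 0] fun u : ℝ => u ^ q := by
  have h := taylor_isLittleO_univ (x₀ := 0) (contDiff_gegenbauer_generating lam hξ hξ' (n := q))
  have hneg : Tendsto (fun u : ℝ => -u) (𝓝[>] 0) (𝓝 0) := by
    have : ContinuousAt (fun u : ℝ => -u) 0 := by fun_prop
    have := this.tendsto.mono_left (nhdsWithin_le_nhds (s := Ioi (0 : ℝ)))
    simpa using this
  have h2 := h.comp_tendsto hneg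
  refine (h2.congr_left ?_).trans_isBigO ?_
  · intro u
    simp only [Function.comp_apply, rieszKernel]
    congr 1
    · congr 2; ring
    · rw [taylor_within_apply]
      refine Finset.sum_congr rfl fun j _ => ?_
      rw [iteratedDerivWithin_univ, gegenbauer, Complex.real_smul]
      push_cast
      ring
  · refine Asymptotics.IsBigO.of_bound 1 (Eventually.of_forall fun u => ?_)
    simp

/-- The coefficient `(λ)ₖ / k! · (4z)ᵏ` in the expansion of the Riesz kernel in powers of
`z = (1 - ξ) / 2`. -/
noncomputable def rieszCoeff (lam : ℂ) (z : ℝ) (k : ℕ) : ℂ :=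
  ordinaryHypergeometricCoefficient lam 1 1 k * (4 * z : ℂ) ^ k

/-- With `z = (1 - ξ) / 2` the Riesz kernel is `((1 + u)² - 4uz) ^ (-λ)`, and the binomial series
in `4uz / (1 + u)² < 1` converges for every `u ≥ 0`. -/
lemma hasSum_rieszKernel (lam : ℂ) {ξ : ℝ} (hξ : -1 < ξ) (hξ' : ξ < 1) {u : ℝ} (hu : 0 ≤ u) :
    HasSum (fun k : ℕ => rieszCoeff lam ((1 - ξ) / 2) k * (u : ℂ) ^ k *
      negBinomRem (2 * lam + 2 * k) 0 u) (rieszKernel lam u ξ) := by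
  set z := (1 - ξ) / 2 with hz
  have h1 : (0 : ℝ) < 1 + u := by linarith
  have hne : ((1 + u : ℝ) : ℂ) ≠ 0 := by exact_mod_cast h1.ne'
  set w : ℝ := 4 * z * u / (1 + u) ^ 2 with hw
  have hw0 : 0 ≤ w := by
    have : 0 ≤ z := by rw [hz]; linarith
    positivity
  have hw1 : w < 1 := by
    rw [hw, div_lt_one (by positivity), hz]
    nlinarith [sq_nonneg (1 - u), quadratic_pos hξ hξ' u]
  have h := (hasSum_one_sub_cpow (-lam) (w : ℂ)
    (by rwa [Complex.norm_real, Real.norm_of_nonneg hw0])).1.mul_left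
      (((1 + u : ℝ) : ℂ) ^ (-(2 * lam)))
  rw [neg_neg] at h
  convert! h using 1
  · ext k
    rw [negBinomRem, Finset.range_zero, Finset.sum_empty, sub_zero, rieszCoeff, neg_add,
      Complex.cpow_add _ _ hne, Complex.cpow_neg _ (2 * (k : ℂ)),
      show (2 * (k : ℂ)) = ((2 * k : ℕ) : ℂ) by push_cast; ring, Complex.cpow_natCast, pow_mul, hw]
    push_cast
    rw [div_pow]
    field_simp
    ring
  · have e : 1 + u ^ 2 + 2 * u * ξ = (1 + u) * ((1 + u) * (1 - w)) := by
      rw [hw, hz]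
      field_simp
      ring
    have hw2 : 0 ≤ 1 - w := by linarith
    rw [rieszKernel, e, Complex.ofReal_mul, Complex.mul_cpow_ofReal_nonneg h1.le (by positivity),
      Complex.ofReal_mul, Complex.mul_cpow_ofReal_nonneg h1.le hw2, ← mul_assoc,
      ← Complex.cpow_add _ _ hne]
    congr 2
    · ring
    · push_cast; rfl

lemma summable_norm_rieszCoeff (lam : ℂ) {z : ℝ} (hz : 0 ≤ z) (hz' : z < 1) :
    Summable (fun k => ‖ordinaryHypergeometricCoefficient lam 1 1 k * (z : ℂ) ^ k‖) := by
  have := (hasSum_one_sub_cpow (-lam) (z : ℂ)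
    (by rwa [Complex.norm_real, Real.norm_of_nonneg hz])).2
  rwa [neg_neg] at this

/-- Since `4u / (1 + u)² ≤ 1`, the terms of index `k ≥ M` are dominated by a summable multiple of
the function with index `M`. -/
lemma norm_rieszTerm_le (lam : ℂ) (z : ℝ) {M k : ℕ} (hk : M ≤ k) {u : ℝ}
    (hu : 0 ≤ u) :
    ‖rieszCoeff lam z k * (u : ℂ) ^ k * negBinomRem (2 * lam + 2 * k) 0 u‖ ≤
      ‖ordinaryHypergeometricCoefficient lam 1 1 k * (z : ℂ) ^ k‖ *
        (4 ^ M * ‖(u : ℂ) ^ M * negBinomRem (2 * lam + 2 * M) 0 u‖) := by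
  have h1 : (0 : ℝ) < 1 + u := by linarith
  -- Both norms carry a factor `(4u / (1 + u)²) ^ m`, with `m = k` and `m = M`.
  have e : ∀ m : ℕ, 4 ^ m * ‖(u : ℂ) ^ m * negBinomRem (2 * lam + 2 * m) 0 u‖ =
      (4 * u / (1 + u) ^ 2) ^ m * (1 + u) ^ (-(2 * lam.re)) := by
    intro m
    rw [norm_mul, norm_negBinomRem_zero _ hu, norm_pow, Complex.norm_real,
      Real.norm_of_nonneg hu]
    have : (2 * lam + 2 * (m : ℂ)).re = 2 * lam.re + ((2 * m : ℕ) : ℝ) := by simp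
    rw [this, neg_add, Real.rpow_add h1, Real.rpow_neg h1.le ((2 * m : ℕ) : ℝ), Real.rpow_natCast,
      pow_mul, div_pow, mul_pow]
    field_simp
  have e2 : ‖rieszCoeff lam z k * (u : ℂ) ^ k * negBinomRem (2 * lam + 2 * k) 0 u‖ =
      ‖ordinaryHypergeometricCoefficient lam 1 1 k * (z : ℂ) ^ k‖ *
        (4 ^ k * ‖(u : ℂ) ^ k * negBinomRem (2 * lam + 2 * k) 0 u‖) := by
    rw [rieszCoeff, mul_pow]
    simp only [norm_mul, norm_pow, Complex.norm_ofNat]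
    ring
  rw [e2, e, e]
  have ht : 4 * u / (1 + u) ^ 2 ≤ 1 := by
    rw [div_le_one (by positivity)]
    nlinarith [sq_nonneg (1 - u)]
  gcongr ?_ * (?_ * ?_)
  exact pow_le_pow_of_le_one (by positivity) ht hk

/-- The order-`q` Taylor polynomial at `0` of the Riesz kernel, as obtained from its expansion in
powers of `z`. -/
noncomputable def rieszPoly (lam : ℂ) (z : ℝ) (q : ℕ) : Polynomial ℂ :=
  ∑ k ∈ Finset.range (q + 1), Polynomial.C (rieszCoeff lam z k) * Polynomial.X ^ k *
    ∑ j ∈ Finset.range (q + 1 - k),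
      Polynomial.C (negBinomCoeff (2 * lam + 2 * k) j) * Polynomial.X ^ j

lemma natDegree_rieszPoly_le (lam : ℂ) (z : ℝ) (q : ℕ) : (rieszPoly lam z q).natDegree ≤ q := by
  refine Polynomial.natDegree_sum_le_of_forall_le _ _ fun k hk => ?_
  rw [Finset.mem_range] at hk
  have h1 : (∑ j ∈ Finset.range (q + 1 - k),
      Polynomial.C (negBinomCoeff (2 * lam + 2 * k) j) * Polynomial.X ^ j).natDegree ≤ q - k := by
    refine Polynomial.natDegree_sum_le_of_forall_le _ _ fun j hj => ?_
    rw [Finset.mem_range] at hj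
    exact (Polynomial.natDegree_C_mul_X_pow_le _ _).trans (by omega)
  refine (Polynomial.natDegree_mul_le_of_le (Polynomial.natDegree_C_mul_X_pow_le _ _) h1).trans ?_
  omega

/-- For `k > q` the number `q + 1 - k` is the truncated `0`, so nothing is subtracted from those
terms. -/
lemma hasSum_rieszKernel_sub_poly (lam : ℂ) (q : ℕ) {ξ : ℝ} (hξ : -1 < ξ) (hξ' : ξ < 1) {u : ℝ}
    (hu : 0 ≤ u) :
    HasSum (fun k : ℕ => rieszCoeff lam ((1 - ξ) / 2) k * (u : ℂ) ^ k *
      negBinomRem (2 * lam + 2 * k) (q + 1 - k) u)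
      (rieszKernel lam u ξ - (rieszPoly lam ((1 - ξ) / 2) q).eval (u : ℂ)) := by
  have h1 := hasSum_rieszKernel lam hξ hξ' hu
  have h2 : HasSum (fun k : ℕ => rieszCoeff lam ((1 - ξ) / 2) k * (u : ℂ) ^ k *
      ∑ j ∈ Finset.range (q + 1 - k), negBinomCoeff (2 * lam + 2 * k) j * (u : ℂ) ^ j)
      ((rieszPoly lam ((1 - ξ) / 2) q).eval (u : ℂ)) := by
    have : (rieszPoly lam ((1 - ξ) / 2) q).eval (u : ℂ) = ∑ k ∈ Finset.range (q + 1),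
        rieszCoeff lam ((1 - ξ) / 2) k * (u : ℂ) ^ k *
      ∑ j ∈ Finset.range (q + 1 - k), negBinomCoeff (2 * lam + 2 * k) j * (u : ℂ) ^ j := by
      simp [rieszPoly, Polynomial.eval_finsetSum]
    rw [this]
    refine hasSum_sum_of_ne_finset_zero fun k hk => ?_
    rw [Finset.mem_range, not_lt] at hk
    rw [Nat.sub_eq_zero_of_le hk]
    simp
  refine (h1.sub h2).congr_fun fun k => ?_
  simp only [negBinomRem, Finset.range_zero, Finset.sum_empty, sub_zero]
  ring

/-- The difference is `O(u ^ (q + 1))`: the terms with `k ≤ q` are Taylor remainders, the others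
contain `u ^ k` and are summable uniformly in `u`. -/
lemma norm_rieszKernel_sub_poly_le (lam : ℂ) (hlam : 0 ≤ lam.re) (q : ℕ) {ξ : ℝ} (hξ : -1 < ξ)
    (hξ' : ξ < 1) :
    ∃ C, ∀ u : ℝ, 0 ≤ u →
      ‖rieszKernel lam u ξ - (rieszPoly lam ((1 - ξ) / 2) q).eval (u : ℂ)‖ ≤ C * u ^ (q + 1) := by
  have hz : (0 : ℝ) ≤ (1 - ξ) / 2 := by linarith
  have hbound : ∀ k : ℕ, ∃ D : ℝ, (q + 1 ≤ k →
      D = ‖ordinaryHypergeometricCoefficient lam 1 1 k * (((1 - ξ) / 2 : ℝ) : ℂ) ^ k‖ * 4 ^ (q + 1))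
      ∧ ∀ u : ℝ, 0 ≤ u → ‖rieszCoeff lam ((1 - ξ) / 2) k * (u : ℂ) ^ k *
      negBinomRem (2 * lam + 2 * k) (q + 1 - k) u‖ ≤ D * u ^ (q + 1) := by
    intro k
    by_cases hk : q + 1 ≤ k
    · refine ⟨_, fun _ => rfl, fun u hu => ?_⟩
      rw [Nat.sub_eq_zero_of_le hk]
      refine (norm_rieszTerm_le lam _ hk hu).trans ?_
      rw [mul_assoc ‖ordinaryHypergeometricCoefficient lam 1 1 k * (((1 - ξ) / 2 : ℝ) : ℂ) ^ k‖]
      refine mul_le_mul_of_nonneg_left (mul_le_mul_of_nonneg_left ?_ (by positivity))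
        (norm_nonneg _)
      rw [norm_mul, norm_pow, Complex.norm_real, Real.norm_of_nonneg hu,
        norm_negBinomRem_zero _ hu]
      refine mul_le_of_le_one_right (by positivity) ?_
      refine Real.rpow_le_one_of_one_le_of_nonpos (by linarith) ?_
      have : (2 * lam + 2 * ((q + 1 : ℕ) : ℂ)).re = 2 * lam.re + 2 * ((q + 1 : ℕ) : ℝ) := by
        simp
      rw [this, neg_nonpos]
      positivity
    · obtain ⟨C, hC, h⟩ := norm_negBinomRem_le (2 * lam + 2 * k)
        (by simp; positivity) (q + 1 - k)
      refine ⟨‖rieszCoeff lam ((1 - ξ) / 2) k‖ * C, fun h => absurd h hk, fun u hu => ?_⟩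
      rw [norm_mul, norm_mul, norm_pow, Complex.norm_real, Real.norm_of_nonneg hu]
      calc _ ≤ ‖rieszCoeff lam ((1 - ξ) / 2) k‖ * u ^ k * (C * u ^ (q + 1 - k)) := by
            gcongr; exact h u hu
        _ = ‖rieszCoeff lam ((1 - ξ) / 2) k‖ * C * (u ^ k * u ^ (q + 1 - k)) := by ring
        _ = _ := by rw [← pow_add, Nat.add_sub_cancel' (by omega)]
  choose D hD hD' using hbound
  have hDs : Summable D := by
    rw [← summable_nat_add_iff (q + 1)]
    have := (summable_nat_add_iff (q + 1)).2
      ((summable_norm_rieszCoeff lam hz (by linarith)).mul_right (4 ^ (q + 1)))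
    refine this.congr fun k => ?_
    rw [hD _ (Nat.le_add_left _ _)]
  refine ⟨∑' k, D k, fun u hu => ?_⟩
  exact (hasSum_rieszKernel_sub_poly lam q hξ hξ' hu).norm_le_of_bounded
    (hDs.hasSum.mul_right _) fun k => hD' k u hu

/-- The polynomial obtained from the expansion in `z` is the Taylor polynomial written with
Gegenbauer polynomials, because both differ from the kernel by `o(u ^ q)`. -/
lemma rieszPoly_eval (lam : ℂ) (hlam : 0 ≤ lam.re) (q : ℕ) {ξ : ℝ} (hξ : -1 < ξ)
    (hξ' : ξ < 1) (u : ℂ) :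
    (rieszPoly lam ((1 - ξ) / 2) q).eval u =
      ∑ j ∈ Finset.range (q + 1), (-u) ^ j * gegenbauer lam j ξ := by
  set Q : Polynomial ℂ := ∑ j ∈ Finset.range (q + 1),
    Polynomial.C ((-1) ^ j * gegenbauer lam j ξ) * Polynomial.X ^ j with hQ
  have hQe : ∀ u : ℂ, Q.eval u = ∑ j ∈ Finset.range (q + 1), (-u) ^ j * gegenbauer lam j ξ := by
    intro u
    simp only [hQ, Polynomial.eval_finsetSum, Polynomial.eval_mul, Polynomial.eval_C,
      Polynomial.eval_pow, Polynomial.eval_X]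
    refine Finset.sum_congr rfl fun j _ => ?_
    rw [neg_pow u]
    ring
  have hQd : Q.natDegree ≤ q := by
    refine Polynomial.natDegree_sum_le_of_forall_le _ _ fun j hj => ?_
    rw [Finset.mem_range] at hj
    exact (Polynomial.natDegree_C_mul_X_pow_le _ _).trans (by omega)
  rw [← hQe]
  congr 1
  rw [← sub_eq_zero]
  refine polynomial_eq_zero_of_isLittleO q _
    (Polynomial.natDegree_sub_le_of_le (natDegree_rieszPoly_le _ _ _) hQd |>.trans (by simp)) ?_
  obtain ⟨C, hC⟩ := norm_rieszKernel_sub_poly_le lam hlam q hξ hξ'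
  have h1 : (fun u : ℝ => rieszKernel lam u ξ - (rieszPoly lam ((1 - ξ) / 2) q).eval (u : ℂ))
      =o[𝓝[>] 0] fun u : ℝ => u ^ q := by
    have hO : (fun u : ℝ => rieszKernel lam u ξ - (rieszPoly lam ((1 - ξ) / 2) q).eval (u : ℂ))
      =O[𝓝[>] 0] fun u : ℝ => u ^ (q + 1) := by
      refine Asymptotics.IsBigO.of_bound C ?_
      filter_upwards [self_mem_nhdsWithin] with u hu
      have hu : 0 < u := hu
      rw [Real.norm_of_nonneg (by positivity)]
      exact hC u hu.le
    refine hO.trans_isLittleO ?_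
    exact (Asymptotics.isLittleO_pow_pow (Nat.lt_succ_self q)).mono nhdsWithin_le_nhds
  refine ((rieszKernel_sub_taylor_isLittleO lam q hξ hξ').sub h1).congr_left fun u => ?_
  rw [Polynomial.eval_sub, hQe]
  ring

lemma weierstrassKernel_eq (lam : ℂ) (hlam : 0 ≤ lam.re) (q : ℕ) {ξ : ℝ} (hξ : -1 < ξ)
    (hξ' : ξ < 1) (u : ℝ) :
    weierstrassKernel lam q u ξ =
      -(rieszKernel lam u ξ - (rieszPoly lam ((1 - ξ) / 2) q).eval (u : ℂ)) := by
  rw [weierstrassKernel, rieszPoly_eval lam hlam q hξ hξ']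
  ring

/-! ### The Mellin transform of the Weierstrass kernel -/

lemma continuous_weierstrassKernel (lam : ℂ) (q : ℕ) {ξ : ℝ} (hξ : -1 < ξ) (hξ' : ξ < 1) :
    Continuous fun u : ℝ => weierstrassKernel lam q u ξ := by
  unfold weierstrassKernel rieszKernel
  refine (Continuous.neg ?_).add (by fun_prop)
  refine Continuous.cpow (by fun_prop) continuous_const fun u => Or.inl ?_
  rw [Complex.ofReal_re]
  exact quadratic_pos hξ hξ' u

lemma mellinConvergent_weierstrassKernel (lam : ℂ) (hlam : 0 ≤ lam.re) (q : ℕ) {ξ : ℝ}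
    (hξ : -1 < ξ) (hξ' : ξ < 1) {ρ : ℂ} (hρ : (q : ℝ) < ρ.re) (hρ' : ρ.re < (q : ℝ) + 1) :
    MellinConvergent (fun u : ℝ => weierstrassKernel lam q u ξ) (-ρ) := by
  obtain ⟨C, hC⟩ := norm_rieszKernel_sub_poly_le lam hlam q hξ hξ'
  refine mellinConvergent_of_norm_le (continuous_weierstrassKernel lam q hξ hξ').continuousOn
    (A := -(q : ℝ)) (B := -(q + 1 : ℝ)) (D := C)
    (C := 1 + ∑ j ∈ Finset.range (q + 1), ‖gegenbauer lam j ξ‖) ?_ ?_ (by simpa using hρ)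
    (by rw [Complex.neg_re]; linarith)
  · filter_upwards [eventually_ge_atTop 2] with u hu
    have h1 : 1 ≤ u ^ q := one_le_pow₀ (by linarith)
    rw [neg_neg, Real.rpow_natCast, weierstrassKernel, add_mul, one_mul]
    refine (norm_add_le _ _).trans (add_le_add ?_ ?_)
    · rw [norm_neg, rieszKernel, Complex.norm_cpow_eq_rpow_re_of_pos (quadratic_pos hξ hξ' u)]
      refine (Real.rpow_le_one_of_one_le_of_nonpos ?_ (by simpa using hlam)).trans h1
      nlinarith
    · rw [Finset.sum_mul]
      refine (norm_sum_le _ _).trans (Finset.sum_le_sum fun j hj => ?_)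
      rw [Finset.mem_range] at hj
      rw [norm_mul, norm_pow, norm_neg, Complex.norm_real, Real.norm_of_nonneg (by linarith),
        mul_comm]
      gcongr
      · linarith
      · omega
  · filter_upwards [self_mem_nhdsWithin] with u hu
    rw [weierstrassKernel_eq lam hlam q hξ hξ', norm_neg, neg_neg]
    exact_mod_cast hC u (le_of_lt hu)

/-- The factor `u ^ k` shifts the argument of the Mellin transform from `-ρ` to `k - ρ`, which lies
in the strip of the Taylor remainder with `q + 1 - k` subtracted terms. -/
lemma hasMellin_rieszTerm (lam : ℂ) (hlam : 0 < lam.re) (z : ℝ) {q : ℕ} {ρ : ℂ}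
    (hρ : (q : ℝ) < ρ.re) (hρ' : ρ.re < (q : ℝ) + 1) (k : ℕ) :
    HasMellin (fun u : ℝ => rieszCoeff lam z k * (u : ℂ) ^ k *
        negBinomRem (2 * lam + 2 * k) (q + 1 - k) u) (-ρ)
      (rieszCoeff lam z k * (Complex.Gamma (-ρ + k) * Complex.Gamma (2 * lam + ρ + k) /
        Complex.Gamma (2 * lam + 2 * k))) := by
  have hk0 : (0 : ℝ) ≤ k := k.cast_nonneg
  have hre : 0 < (2 * lam + 2 * (k : ℂ)).re := by simp; positivity
  have hq0 : (0 : ℝ) ≤ q := q.cast_nonneg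
  have key : MellinConvergent (negBinomRem (2 * lam + 2 * k) (q + 1 - k)) (-ρ + k) ∧
      mellin (negBinomRem (2 * lam + 2 * k) (q + 1 - k)) (-ρ + k) =
        Complex.Gamma (-ρ + k) * Complex.Gamma (2 * lam + 2 * k - (-ρ + k)) /
          Complex.Gamma (2 * lam + 2 * k) := by
    by_cases hk : k ≤ q
    · obtain ⟨m, rfl⟩ := Nat.exists_eq_add_of_le hk
      rw [show k + m + 1 - k = m + 1 by omega]
      push_cast at hρ hρ'
      have h1 : -(m + 1 : ℝ) < (-ρ + k).re := by simp; linarith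
      have h2 : (-ρ + k).re < -(m : ℝ) := by simp; linarith
      exact ⟨mellinConvergent_negBinomRem_succ _ _ _ hre.le h1 h2,
        mellin_negBinomRem_succ _ _ _ hre h1 h2⟩
    · rw [Nat.sub_eq_zero_of_le (by omega)]
      have hk' : (q : ℝ) + 1 ≤ k := by exact_mod_cast (by omega : q + 1 ≤ k)
      have h1 : 0 < (-ρ + k).re := by simp; linarith
      have h2 : (-ρ + k).re < (2 * lam + 2 * (k : ℂ)).re := by simp; linarith
      exact ⟨mellinConvergent_negBinomRem_zero _ _ h1 h2, mellin_negBinomRem_zero _ _ h1 h2⟩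
  rw [show 2 * lam + 2 * (k : ℂ) - (-ρ + k) = 2 * lam + ρ + k by ring] at key
  have h3 : MellinConvergent (fun u : ℝ => (u : ℂ) ^ (k : ℂ) •
      negBinomRem (2 * lam + 2 * k) (q + 1 - k) u) (-ρ) := MellinConvergent.cpow_smul.2 key.1
  have h4 := hasMellin_const_smul h3 (rieszCoeff lam z k)
  rw [mellin_cpow_smul, key.2] at h4
  simpa only [smul_eq_mul, Complex.cpow_natCast, mul_assoc] using h4

lemma ascPochhammer_two_mul_eval (x : ℂ) (k : ℕ) :
    (ascPochhammer ℂ (2 * k)).eval (2 * x) =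
      4 ^ k * (ascPochhammer ℂ k).eval x * (ascPochhammer ℂ k).eval (x + 1 / 2) := by
  induction k with
  | zero => simp
  | succ k ih =>
    rw [show 2 * (k + 1) = 2 * k + 1 + 1 by ring]
    simp only [ascPochhammer_succ_eval, ih]
    push_cast
    ring

lemma ne_neg_natCast_of_re_pos {x : ℂ} (hx : 0 < x.re) (k : ℕ) : x ≠ -k := by
  rintro rfl
  have : (0 : ℝ) ≤ k := k.cast_nonneg
  simp at hx
  linarith

lemma neg_ne_neg_natCast {q : ℕ} {ρ : ℂ} (hρ : (q : ℝ) < ρ.re) (hρ' : ρ.re < (q : ℝ) + 1) (k : ℕ) :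
    -ρ ≠ -(k : ℂ) := by
  intro h
  rw [neg_inj] at h
  rw [h, Complex.natCast_re] at hρ hρ'
  norm_cast at hρ hρ'
  omega

lemma rieszTerm_mellin_eq (lam : ℂ) (hlam : 0 < lam.re) (z : ℝ) {q : ℕ} {ρ : ℂ}
    (hρ : (q : ℝ) < ρ.re) (hρ' : ρ.re < (q : ℝ) + 1) (k : ℕ) :
    rieszCoeff lam z k * (Complex.Gamma (-ρ + k) * Complex.Gamma (2 * lam + ρ + k) /
        Complex.Gamma (2 * lam + 2 * k)) =
      Complex.Gamma (-ρ) * Complex.Gamma (2 * lam + ρ) / Complex.Gamma (2 * lam) *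
        (ordinaryHypergeometricCoefficient (-ρ) (2 * lam + ρ) (lam + 1 / 2) k * (z : ℂ) ^ k) := by
  have hq0 : (0 : ℝ) ≤ q := q.cast_nonneg
  have p1 : 0 < (2 * lam + ρ).re := by simp; linarith
  have p2 : 0 < (2 * lam).re := by simp; linarith
  have p3 : 0 < (lam + 1 / 2).re := by simp; linarith
  have e1 := Complex.Gamma_add_nat_div_Gamma_eq (n := k) (-ρ) (neg_ne_neg_natCast hρ hρ')
  have e2 := Complex.Gamma_add_nat_div_Gamma_eq (n := k) _ (ne_neg_natCast_of_re_pos p1)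
  have e3 := Complex.Gamma_add_nat_div_Gamma_eq (n := 2 * k) _ (ne_neg_natCast_of_re_pos p2)
  have g1 := Complex.Gamma_ne_zero (neg_ne_neg_natCast hρ hρ')
  have g2 := Complex.Gamma_ne_zero (ne_neg_natCast_of_re_pos p1)
  have g3 := Complex.Gamma_ne_zero (ne_neg_natCast_of_re_pos p2)
  have hpoch : ∀ x : ℂ, 0 < x.re → (ascPochhammer ℂ k).eval x ≠ 0 := by
    intro x hx h
    obtain ⟨j, -, hj⟩ := (ascPochhammer_eval_eq_zero_iff _ _).1 h
    exact ne_neg_natCast_of_re_pos hx j (by rw [hj, neg_neg])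
  have n1 := hpoch lam hlam
  have n2 := hpoch _ p3
  have h3 : (k ! : ℂ) ≠ 0 := by exact_mod_cast k.factorial_ne_zero
  rw [div_eq_iff g1] at e1
  rw [div_eq_iff g2] at e2
  rw [div_eq_iff g3, ascPochhammer_two_mul_eval] at e3
  push_cast at e3
  rw [e1, e2, e3, rieszCoeff, ordinaryHypergeometricCoefficient_one_one,
    ordinaryHypergeometricCoefficient, mul_pow]
  field_simp

lemma summable_integral_norm_rieszTerm (lam : ℂ) (hlam : 0 < lam.re) {z : ℝ} (hz : 0 ≤ z)
    (hz' : z < 1) {q : ℕ} {ρ : ℂ} (hρ : (q : ℝ) < ρ.re) (hρ' : ρ.re < (q : ℝ) + 1) :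
    Summable fun k : ℕ => ∫ u in Ioi (0 : ℝ), ‖(u : ℂ) ^ (-ρ - 1) •
      (rieszCoeff lam z k * (u : ℂ) ^ k * negBinomRem (2 * lam + 2 * k) (q + 1 - k) u)‖ := by
  -- Up to the constant `4 ^ (q + 1)`, `Φ` is the norm of the first term from which nothing is
  -- subtracted; it dominates all later ones.
  set Φ : ℝ → ℝ := fun u => 4 ^ (q + 1) * ‖(u : ℂ) ^ (-ρ - 1) • ((u : ℂ) ^ ((q + 1 : ℕ) : ℂ) •
    negBinomRem (2 * lam + 2 * (q + 1 : ℕ)) 0 u)‖ with hΦ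
  have hq0 : (0 : ℝ) ≤ q := q.cast_nonneg
  have hΦi : IntegrableOn Φ (Ioi 0) := by
    have h1 : 0 < (-ρ + (q + 1 : ℕ)).re := by simp; linarith
    have h2 : (-ρ + (q + 1 : ℕ)).re < (2 * lam + 2 * ((q + 1 : ℕ) : ℂ)).re := by simp; linarith
    have := MellinConvergent.cpow_smul.2 (mellinConvergent_negBinomRem_zero _ _ h1 h2)
    exact (Integrable.norm this).const_mul _
  rw [← summable_nat_add_iff (q + 1)]
  refine Summable.of_nonneg_of_le (fun k => integral_nonneg fun u => norm_nonneg _) (fun k => ?_)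
    (((summable_nat_add_iff (q + 1)).2 (summable_norm_rieszCoeff lam hz hz')).mul_right
      (∫ u in Ioi (0 : ℝ), Φ u))
  rw [← integral_const_mul]
  refine setIntegral_mono_on
    (Integrable.norm (hasMellin_rieszTerm lam hlam z hρ hρ' (k + (q + 1))).1)
    (hΦi.const_mul _) measurableSet_Ioi fun u hu => ?_
  have hu : 0 < u := hu
  have := norm_rieszTerm_le lam z (Nat.le_add_left (q + 1) k) hu.le
  rw [Nat.sub_eq_zero_of_le (by omega), norm_smul]
  refine (mul_le_mul_of_nonneg_left this (norm_nonneg _)).trans (le_of_eq ?_)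
  rw [hΦ]
  simp only [norm_smul, norm_mul, Complex.cpow_natCast]
  ring

/-- Term-by-term integration of the expansion of the kernel in powers of `(1 - ξ) / 2`. -/
theorem hasMellin_weierstrassKernel (lam : ℂ) (hlam : 0 < lam.re) (q : ℕ) {ξ : ℝ}
    (hξ : -1 < ξ) (hξ' : ξ < 1) {ρ : ℂ} (hρ : (q : ℝ) < ρ.re) (hρ' : ρ.re < (q : ℝ) + 1) :
    HasMellin (fun u : ℝ => weierstrassKernel lam q u ξ) (-ρ)
      (-(Complex.Gamma (-ρ) * Complex.Gamma (2 * lam + ρ) / Complex.Gamma (2 * lam) *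
        ordinaryHypergeometric (-ρ) (2 * lam + ρ) (lam + 1 / 2) (((1 - ξ) / 2 : ℝ) : ℂ))) := by
  refine ⟨mellinConvergent_weierstrassKernel lam hlam.le q hξ hξ' hρ hρ', ?_⟩
  set z := (1 - ξ) / 2 with hz
  have h := hasSum_integral_of_summable_integral_norm
    (fun k => (hasMellin_rieszTerm lam hlam z hρ hρ' k).1)
    (summable_integral_norm_rieszTerm lam hlam (by rw [hz]; linarith) (by rw [hz]; linarith) hρ hρ')
  have h1 : ∀ k : ℕ, ∫ u in Ioi (0 : ℝ), (u : ℂ) ^ (-ρ - 1) •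
      (rieszCoeff lam z k * (u : ℂ) ^ k * negBinomRem (2 * lam + 2 * k) (q + 1 - k) u) =
      Complex.Gamma (-ρ) * Complex.Gamma (2 * lam + ρ) / Complex.Gamma (2 * lam) *
        (ordinaryHypergeometricCoefficient (-ρ) (2 * lam + ρ) (lam + 1 / 2) k * (z : ℂ) ^ k) :=
    fun k => (hasMellin_rieszTerm lam hlam z hρ hρ' k).2.trans
      (rieszTerm_mellin_eq lam hlam z hρ hρ' k)
  simp only [h1] at h
  have h2 : ∫ u in Ioi (0 : ℝ), ∑' k : ℕ, (u : ℂ) ^ (-ρ - 1) •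
      (rieszCoeff lam z k * (u : ℂ) ^ k * negBinomRem (2 * lam + 2 * k) (q + 1 - k) u) =
      -mellin (fun u : ℝ => weierstrassKernel lam q u ξ) (-ρ) := by
    rw [mellin, ← integral_neg]
    refine setIntegral_congr_fun measurableSet_Ioi fun u hu => ?_
    have hu : 0 < u := hu
    rw [((hasSum_rieszKernel_sub_poly lam q hξ hξ' hu.le).const_smul ((u : ℂ) ^ (-ρ - 1))).tsum_eq,
      weierstrassKernel_eq lam hlam.le q hξ hξ', smul_neg, neg_neg]
  rw [h2] at h
  rw [← neg_eq_iff_eq_neg, ← h.tsum_eq, tsum_mul_left, ordinaryHypergeometric_eq_tsum]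
  simp only [smul_eq_mul, ordinaryHypergeometricCoefficient]

/-! ### Reduction to the associated Legendre function -/

/-- Legendre's duplication formula at `(m + 1) / 2`. -/
lemma sqrt_pi_mul_factorial (m : ℕ) :
    (Real.sqrt Real.pi : ℂ) * (m ! : ℂ) =
      2 ^ m * Complex.Gamma ((m + 2) / 2) * Complex.Gamma ((m + 1) / 2) := by
  have h := Complex.Gamma_mul_Gamma_add_half (((m : ℂ) + 1) / 2)
  rw [show 2 * (((m : ℂ) + 1) / 2) = m + 1 by ring, Complex.Gamma_nat_eq_factorial,
    show ((m : ℂ) + 1) / 2 + 1 / 2 = (m + 2) / 2 by ring,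
    show (1 : ℂ) - (m + 1) = -m by ring, Complex.cpow_neg, Complex.cpow_natCast] at h
  rw [mul_assoc, mul_comm (Complex.Gamma _), h]
  field_simp

/-- The reflection formula at `-ρ`, followed by `m` steps of the functional equation of `Γ`. -/
lemma gamma_neg_mul_gamma (m : ℕ) {q : ℕ} {ρ : ℂ} (hρ : (q : ℝ) < ρ.re)
    (hρ' : ρ.re < (q : ℝ) + 1) :
    -(Complex.Gamma (-ρ) * Complex.Gamma (m + 1 + ρ)) =
      Real.pi / Complex.sin (Real.pi * ρ) * ∏ k ∈ Finset.Icc 1 m, (ρ + (k : ℂ)) := by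
  have hq0 : (0 : ℝ) ≤ q := q.cast_nonneg
  induction m with
  | zero =>
    have h := Complex.Gamma_mul_Gamma_one_sub (-ρ)
    rw [mul_neg, Complex.sin_neg, div_neg, sub_neg_eq_add] at h
    simp [h]
  | succ m ih =>
    have hne : (m : ℂ) + 1 + ρ ≠ 0 := fun h => by
      have := congrArg Complex.re h
      have hm : (0 : ℝ) ≤ m := m.cast_nonneg
      simp at this
      linarith
    rw [Finset.prod_Icc_succ_top (by omega), ← mul_assoc, ← ih]
    push_cast
    rw [show (m : ℂ) + 1 + 1 + ρ = (m + 1 + ρ) + 1 by ring, Complex.Gamma_add_one _ hne]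
    ring

/-- Euler's transformation produces `((1 + ξ) / 2) ^ (m / 2)`, which cancels the powers of `1 + ξ`
and `1 - ξ` in front of the Legendre function. -/
lemma legendreP_eq (m : ℕ) {q : ℕ} {ξ : ℝ} (hξ : -1 < ξ) (hξ' : ξ < 1) {ρ : ℂ}
    (hρ : (q : ℝ) < ρ.re) (hρ' : ρ.re < (q : ℝ) + 1) :
    ((1 - ξ ^ 2 : ℝ) : ℂ) ^ (-(m : ℂ) / 4) * legendreP (-(m : ℂ) / 2) (-ρ - (m + 2) / 2) ξ =
      (Complex.Gamma ((m + 2) / 2))⁻¹ * 2 ^ (-(m : ℂ) / 2) *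
        ordinaryHypergeometric (-ρ) (m + 1 + ρ) ((m + 2) / 2) (((1 - ξ) / 2 : ℝ) : ℂ) := by
  have hq0 : (0 : ℝ) ≤ q := q.cast_nonneg
  have hm : (0 : ℝ) ≤ m := m.cast_nonneg
  have h1 : 0 < 1 + ξ := by linarith
  have h2 : 0 < 1 - ξ := by linarith
  have n1 : ((1 + ξ : ℝ) : ℂ) ≠ 0 := by exact_mod_cast h1.ne'
  have n2 : ((1 - ξ : ℝ) : ℂ) ≠ 0 := by exact_mod_cast h2.ne'
  have hinv : ∀ w : ℂ, (((1 - ξ)⁻¹ : ℝ) : ℂ) ^ w = ((1 - ξ : ℝ) : ℂ) ^ (-w) := by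
    intro w
    rw [Complex.ofReal_inv, Complex.inv_cpow _ _ (by
      rw [Complex.arg_ofReal_of_nonneg h2.le]; exact Real.pi_pos.ne), Complex.cpow_neg]
  have heuler := ordinaryHypergeometric_euler (ρ + (m + 2) / 2) (-ρ - m / 2) ((m + 2) / 2)
    (((1 - ξ) / 2 : ℝ) : ℂ)
    (by rw [Complex.norm_real, Real.norm_of_nonneg (by linarith)]; linarith)
    (fun k => by
      rw [show ((m : ℂ) + 2) / 2 - (ρ + (m + 2) / 2) = -ρ by ring]
      exact neg_ne_neg_natCast hρ hρ' k)
    (ne_neg_natCast_of_re_pos (by simp; linarith))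
    (ne_neg_natCast_of_re_pos (by simp; linarith))
  rw [show ((m : ℂ) + 2) / 2 - (ρ + (m + 2) / 2) = -ρ by ring,
    show ((m : ℂ) + 2) / 2 - (-ρ - m / 2) = m + 1 + ρ by ring,
    show -ρ - (-ρ - (m : ℂ) / 2) = m / 2 by ring,
    show (1 : ℂ) - (((1 - ξ) / 2 : ℝ) : ℂ) = (((1 + ξ) * 2⁻¹ : ℝ) : ℂ) by push_cast; ring,
    Complex.ofReal_mul, Complex.mul_cpow_ofReal_nonneg h1.le (by norm_num)] at heuler
  rw [legendreP, show -(-ρ - ((m : ℂ) + 2) / 2) = ρ + (m + 2) / 2 by ring,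
    show -ρ - ((m : ℂ) + 2) / 2 + 1 = -ρ - m / 2 by ring,
    show (1 : ℂ) - -(m : ℂ) / 2 = (m + 2) / 2 by ring, heuler,
    show 1 - ξ ^ 2 = (1 + ξ) * (1 - ξ) by ring, div_eq_mul_inv (1 + ξ), Complex.ofReal_mul,
    Complex.ofReal_mul, Complex.mul_cpow_ofReal_nonneg h1.le h2.le,
    Complex.mul_cpow_ofReal_nonneg h1.le (by positivity), hinv,
    show -(-(m : ℂ) / 2 / 2) = m / 4 by ring, show -(m : ℂ) / 2 / 2 = -(m / 4) by ring,
    show -(m : ℂ) / 4 = -(m / 4) by ring, show -(m : ℂ) / 2 = -(m / 2) by ring]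
  have hm4 : (m : ℂ) / 2 = m / 4 + m / 4 := by ring
  have hhalf : (((2⁻¹ : ℝ)) : ℂ) ^ ((m : ℂ) / 2) = (2 : ℂ) ^ (-((m : ℂ) / 2)) := by
    rw [Complex.ofReal_inv, Complex.inv_cpow _ _ (by
      rw [Complex.arg_ofReal_of_nonneg (by norm_num)]; exact Real.pi_pos.ne), Complex.cpow_neg]
    simp
  rw [hhalf, show ((1 + ξ : ℝ) : ℂ) ^ ((m : ℂ) / 2) =
    ((1 + ξ : ℝ) : ℂ) ^ ((m : ℂ) / 4) * ((1 + ξ : ℝ) : ℂ) ^ ((m : ℂ) / 4) by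
      rw [hm4, Complex.cpow_add _ _ n1]]
  have c1 : ((1 + ξ : ℝ) : ℂ) ^ ((m : ℂ) / 4) ≠ 0 := fun h =>
    n1 ((Complex.cpow_eq_zero_iff _ _).1 h).1
  have c2 : ((1 - ξ : ℝ) : ℂ) ^ ((m : ℂ) / 4) ≠ 0 := fun h =>
    n2 ((Complex.cpow_eq_zero_iff _ _).1 h).1
  rw [Complex.cpow_neg _ ((m : ℂ) / 4), Complex.cpow_neg _ ((m : ℂ) / 4)]
  field_simp

theorem mainTheorem2 (n : ℕ) (hn : 3 ≤ n) (q : ℕ) (ξ : ℝ) (hξ : -1 < ξ) (hξ' : ξ < 1)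
    (ρ : ℂ) (hρ : (q : ℝ) < ρ.re) (hρ' : ρ.re < (q : ℝ) + 1) :
    HasMellin (fun u : ℝ => weierstrassKernel (((n : ℂ) - 2) / 2) q u ξ) (-ρ)
      ((Real.pi : ℂ) * (Real.sqrt Real.pi : ℂ) * (2 : ℂ) ^ ((3 - (n : ℂ)) / 2) *
          (∏ k ∈ Finset.Icc 1 (n - 3), (ρ + (k : ℂ))) *
          ((1 - ξ ^ 2 : ℝ) : ℂ) ^ ((3 - (n : ℂ)) / 4) /
        (Complex.sin ((Real.pi : ℂ) * ρ) * Complex.Gamma (((n : ℂ) - 2) / 2)) *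
        legendreP ((3 - (n : ℂ)) / 2) (-ρ - ((n : ℂ) - 1) / 2) ξ) ∧
    (Real.sqrt Real.pi : ℂ) * ((n - 3).factorial : ℂ) =
      (2 : ℂ) ^ (n - 3) * Complex.Gamma (((n : ℂ) - 1) / 2) * Complex.Gamma (((n : ℂ) - 2) / 2) ∧
    HasMellin (fun u : ℝ => weierstrassKernel (((n : ℂ) - 2) / 2) q u ξ) (-ρ)
      ((Real.pi : ℂ) * (2 : ℂ) ^ (((n : ℂ) - 3) / 2) *
          (∏ k ∈ Finset.Icc 1 (n - 3), (ρ + (k : ℂ))) *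
          Complex.Gamma (((n : ℂ) - 1) / 2) *
          ((1 - ξ ^ 2 : ℝ) : ℂ) ^ ((3 - (n : ℂ)) / 4) /
        (((n - 3).factorial : ℂ) * Complex.sin ((Real.pi : ℂ) * ρ)) *
        legendreP ((3 - (n : ℂ)) / 2) (-ρ - ((n : ℂ) - 1) / 2) ξ) := by
  -- In terms of `m = n - 3`, `2λ = m + 1` and `λ + 1/2 = (m + 2) / 2`.
  obtain ⟨m, rfl⟩ := Nat.exists_eq_add_of_le' hn
  have hm : (0 : ℝ) ≤ m := m.cast_nonneg
  have hdup := sqrt_pi_mul_factorial m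
  have hM := hasMellin_weierstrassKernel (((m : ℂ) + 1) / 2) (by simp; linarith) q hξ hξ' hρ hρ'
  have hL := legendreP_eq m hξ hξ' hρ hρ'
  have hG := gamma_neg_mul_gamma m hρ hρ'
  rw [show 2 * (((m : ℂ) + 1) / 2) = m + 1 by ring,
    show ((m : ℂ) + 1) / 2 + 1 / 2 = (m + 2) / 2 by ring, Complex.Gamma_nat_eq_factorial,
    ← neg_mul, ← neg_div, hG] at hM
  have g1 : Complex.Gamma (((m : ℂ) + 1) / 2) ≠ 0 :=
    Complex.Gamma_ne_zero_of_re_pos (by simp; linarith)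
  have g2 : Complex.Gamma (((m : ℂ) + 2) / 2) ≠ 0 :=
    Complex.Gamma_ne_zero_of_re_pos (by simp; linarith)
  have hf : (m ! : ℂ) ≠ 0 := by exact_mod_cast m.factorial_ne_zero
  have hpow : (2 : ℂ) ^ ((m : ℂ) / 2) * (2 : ℂ) ^ ((m : ℂ) / 2) = 2 ^ m := by
    rw [← Complex.cpow_add _ _ two_ne_zero, add_halves, Complex.cpow_natCast]
  have c2 : (2 : ℂ) ^ ((m : ℂ) / 2) ≠ 0 := by simp [Complex.cpow_eq_zero_iff]
  have hneg : (2 : ℂ) ^ (-(m : ℂ) / 2) = ((2 : ℂ) ^ ((m : ℂ) / 2))⁻¹ := by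
    rw [← Complex.cpow_neg, neg_div]
  rw [hneg] at hL
  rw [Nat.add_sub_cancel]
  push_cast
  rw [show ((m : ℂ) + 3 - 2) / 2 = (m + 1) / 2 by ring,
    show (3 - ((m : ℂ) + 3)) / 2 = -m / 2 by ring, show (3 - ((m : ℂ) + 3)) / 4 = -m / 4 by ring,
    show ((m : ℂ) + 3 - 1) / 2 = (m + 2) / 2 by ring, show ((m : ℂ) + 3 - 3) / 2 = m / 2 by ring,
    hneg]
  push_cast at hL hM
  rw [← hpow] at hdup
  refine ⟨?_, by rw [hdup, hpow], ?_⟩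
  · convert! hM using 1
    rw [div_mul_eq_mul_div, mul_assoc _ (_ ^ (-(m : ℂ) / 4)), hL]
    field_simp
    linear_combination ((∏ k ∈ Finset.Icc 1 m, (ρ + (k : ℂ))) *
      ordinaryHypergeometric (-ρ) (m + 1 + ρ) (((m : ℂ) + 2) / 2) ((1 - (ξ : ℂ)) / 2) *
      (Complex.sin (Real.pi * ρ))⁻¹) * hdup
  · convert! hM using 1
    rw [div_mul_eq_mul_div, mul_assoc _ (_ ^ (-(m : ℂ) / 4)), hL]
    field_simp
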